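/- Let $D\in\mathbb{R}^{m\times n}$ and $\alpha\ge 0$. Write $\|\cdot\|_*$ for the nuclear norm (the sum of the singular values), $\|\cdot\|_F$ for the Frobenius norm, and $\sigma_1\ge\sigma_2\ge\cdots$ for the singular values of $D$. A skinny SVD of a matrix $A$ of rank $r$ is a factorisation $A=U\Sigma V^T$ in which $U$ and $V$ have $r$ orthonormal columns and $\Sigma$ is an $r\times r$ diagonal matrix with positive, non-increasing diagonal entries. The problem $\min_C\|C\|_*$ subject to $D=DC$ has exactly one optimal solution $C^*$. It has a skinny SVD $C^*=U_C\Sigma_CV_C^T$ in which the columns of $V_C$ are right singular vectors of $D$ in order of decreasing singular value, that is, $D=U\Sigma V_C^T$ is a skinny SVD of $D$ for some $U$ and $\Sigma$. Let $C^*=U_C\Sigma_CV_C^T$ be any skinny SVD with this property, and let $k^*$ be a minimiser of $k+\frac{\alpha}{2}\sum_{i>k}\sigma_i^2$ over the integers $k\ge 0$. Let $\mathcal H_{k}$ be the operator that retains the first $k$ diagonal entries and sets the others to zero. Then $$C_0^*=U_C\,\mathcal H_{k^*}(\Sigma_C)\,V_C^T$$ is an optimal solution (together with suitable $D_0$ and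 $D_e$) of $$\min_{C_0,D_0}\ \|C_0\|_*+\frac{\alpha}{2}\|D_e\|_F^2\quad\text{subject to}\quad D_0=D_0C_0,\ D=D_0+D_e .$$ If the minimiser $k^*$ is unique, then every optimal solution of this problem has $C_0=C_0^*$. -/

import Mathlib

open scoped Matrix

namespace LowRankRep

noncomputable section

attribute [local instance] Matrix.frobeniusNormedAddCommGroup

/-- The singular values of a real matrix, in decreasing order with multiplicity and indexed from
`0`: `singularValue A i` is the `(i + 1)`-st largest one. They are `0` for `i ≥ rank A`. -/
def singularValue {m n : ℕ} (A : Matrix (Fin m) (Fin n) ℝ) (i : ℕ) : ℝ :=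
  (Matrix.toEuclideanLin A).singularValues i

/-- The nuclear norm: the sum of the singular values. -/
def nuclearNorm {m n : ℕ} (A : Matrix (Fin m) (Fin n) ℝ) : ℝ :=
  ∑ i ∈ Finset.range n, singularValue A i

/-- `A = U * diag(s) * Vᵀ` is a skinny singular value decomposition: `U` and `V` have orthonormal
columns and the `s i` are positive and listed in decreasing order (so `r` is the rank of `A`). -/
structure IsSkinnySVD {m n r : ℕ} (A : Matrix (Fin m) (Fin n) ℝ)
    (U : Matrix (Fin m) (Fin r) ℝ) (s : Fin r → ℝ) (V : Matrix (Fin n) (Fin r) ℝ) : Prop where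
  left_orthonormal : Uᵀ * U = 1
  right_orthonormal : Vᵀ * V = 1
  pos : ∀ i, 0 < s i
  antitone : Antitone s
  eq : A = U * Matrix.diagonal s * Vᵀ

/-- The truncation operator: keep the first `k` entries and set the other ones to zero. -/
def truncate (k : ℕ) {r : ℕ} (s : Fin r → ℝ) : Fin r → ℝ :=
  fun i => if (i : ℕ) < k then s i else 0

/-- `C` is an optimal solution of `min ‖C‖_*` subject to `D = D C`. -/
def IsCleanOptimal {m n : ℕ} (D : Matrix (Fin m) (Fin n) ℝ) (C : Matrix (Fin n) (Fin n) ℝ) :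
    Prop :=
  D = D * C ∧ ∀ C' : Matrix (Fin n) (Fin n) ℝ, D = D * C' → nuclearNorm C ≤ nuclearNorm C'

/-- The constraints `D₀ = D₀ C₀` and `D = D₀ + Dₑ`. -/
def IsFeasible {m n : ℕ} (D : Matrix (Fin m) (Fin n) ℝ)
    (C₀ : Matrix (Fin n) (Fin n) ℝ) (D₀ Dₑ : Matrix (Fin m) (Fin n) ℝ) : Prop :=
  D₀ = D₀ * C₀ ∧ D = D₀ + Dₑ

/-- The objective `‖C₀‖_* + (α / 2) ‖Dₑ‖_F²`; the norm of `Dₑ` is the Frobenius norm. -/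
def objective {m n : ℕ} (α : ℝ) (C₀ : Matrix (Fin n) (Fin n) ℝ)
    (Dₑ : Matrix (Fin m) (Fin n) ℝ) : ℝ :=
  nuclearNorm C₀ + α / 2 * ‖Dₑ‖ ^ 2

/-- `(C₀, D₀, Dₑ)` is an optimal solution of `min ‖C₀‖_* + (α / 2) ‖Dₑ‖_F²` subject to
`D₀ = D₀ C₀` and `D = D₀ + Dₑ`. -/
def IsNoisyOptimal {m n : ℕ} (D : Matrix (Fin m) (Fin n) ℝ) (α : ℝ)
    (C₀ : Matrix (Fin n) (Fin n) ℝ) (D₀ Dₑ : Matrix (Fin m) (Fin n) ℝ) : Prop :=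
  IsFeasible D C₀ D₀ Dₑ ∧
    ∀ (C₀' : Matrix (Fin n) (Fin n) ℝ) (D₀' Dₑ' : Matrix (Fin m) (Fin n) ℝ),
      IsFeasible D C₀' D₀' Dₑ' → objective α C₀ Dₑ ≤ objective α C₀' Dₑ'

/-- The function `k ↦ k + (α / 2) ∑_{i > k} σᵢ²`. With indices from `0`, the singular values
beyond the `k` largest ones are those of index `≥ k`. -/
def rankCost {m n : ℕ} (D : Matrix (Fin m) (Fin n) ℝ) (α : ℝ) (k : ℕ) : ℝ :=
  k + α / 2 * ∑ i ∈ Finset.Ico k n, singularValue D i ^ 2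

/-- `k` is a minimiser of `rankCost D α` over the natural numbers. -/
def IsArgmin {m n : ℕ} (D : Matrix (Fin m) (Fin n) ℝ) (α : ℝ) (k : ℕ) : Prop :=
  ∀ j : ℕ, rankCost D α k ≤ rankCost D α j

end

end LowRankRep

namespace LowRankRep

open Matrix Finset

attribute [local instance] Matrix.frobeniusNormedAddCommGroup

/-! For a feasible triple, let `P` be the orthogonal projection onto the row space of `D₀`. The
constraint `D₀ = D₀ C₀` gives `P C₀ = P`, hence `‖C₀‖_* ≥ tr P` with equality only for `C₀ = P`
(`trace_le_nuclearNorm`). Since `D₀` vanishes on the range of `1 - P`, also `‖Dₑ‖² ≥ tr (Dᵀ D (1 -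
P))`. So the problem reduces to one over projections.

In an orthonormal eigenbasis `W` of `Dᵀ D`, put `pᵢ = (Wᵀ P W)ᵢᵢ`, a number in `[0, 1]`. The reduced
objective is `∑ (pᵢ + (α/2) σᵢ² (1 - pᵢ))`, affine in each `pᵢ`, so each term is at least `min 1
((α/2) σᵢ²)`. A minimiser `k` of `rankCost` is a place where `(α/2) σᵢ²` passes the threshold `1`,
so the projection onto the first `k` eigenvectors attains the bound. If `k` is unique, no term ties
with `1`; equality then forces `pᵢ` to be `0` or `1`, which determines `P`.

The same trace bound shows that the clean problem has the single solution `V Vᵀ`. In a skinny SVD of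
it with right factor `V`, the left factor is `V` and all singular values are `1`, so truncation
yields exactly that leading projection. -/

lemma frobenius_norm_sq_eq_trace {m n : ℕ} (A : Matrix (Fin m) (Fin n) ℝ) :
    ‖A‖ ^ 2 = (Aᵀ * A).trace := by
  rw [Matrix.frobenius_norm_def, ← Real.sqrt_eq_rpow, Real.sq_sqrt (by positivity)]
  simp only [Matrix.trace, Matrix.diag, Matrix.mul_apply, Matrix.transpose_apply]
  rw [Finset.sum_comm]
  simp [sq]

lemma gram_diag_nonneg {m n : ℕ} (A : Matrix (Fin m) (Fin n) ℝ) (i : Fin n) :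
    0 ≤ (Aᵀ * A) i i := by
  simp only [Matrix.mul_apply, Matrix.transpose_apply]
  exact Finset.sum_nonneg fun j _ => mul_self_nonneg _

lemma col_eq_zero_of_gram_diag {m n : ℕ} {A : Matrix (Fin m) (Fin n) ℝ} {i : Fin n}
    (h : (Aᵀ * A) i i ≤ 0) (j : Fin m) : A j i = 0 := by
  have h0 := le_antisymm h (gram_diag_nonneg A i)
  simp only [Matrix.mul_apply, Matrix.transpose_apply] at h0
  rw [Finset.sum_eq_zero_iff_of_nonneg fun j _ => mul_self_nonneg _] at h0
  exact mul_self_eq_zero.1 (h0 j (Finset.mem_univ j))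

lemma diag_transpose_mul_sq_le {m n : ℕ} (A B : Matrix (Fin m) (Fin n) ℝ) (i : Fin n) :
    (Aᵀ * B) i i ^ 2 ≤ (Aᵀ * A) i i * (Bᵀ * B) i i := by
  simp only [Matrix.mul_apply, Matrix.transpose_apply, ← sq]
  exact Finset.sum_mul_sq_le_sq_mul_sq _ _ _

/-! ### Singular values and the Gram matrix. -/

lemma singularValue_nonneg {m n : ℕ} (A : Matrix (Fin m) (Fin n) ℝ) (i : ℕ) :
    0 ≤ singularValue A i := LinearMap.singularValues_nonneg _ _

lemma singularValue_antitone {m n : ℕ} (A : Matrix (Fin m) (Fin n) ℝ) :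
    Antitone (singularValue A) := LinearMap.singularValues_antitone _

lemma singularValue_of_le {m n : ℕ} (A : Matrix (Fin m) (Fin n) ℝ) {i : ℕ} (hi : n ≤ i) :
    singularValue A i = 0 :=
  LinearMap.singularValues_of_finrank_le _ (by simpa using hi)

lemma nuclearNorm_eq_sum_fin {m n : ℕ} (A : Matrix (Fin m) (Fin n) ℝ) :
    nuclearNorm A = ∑ i : Fin n, singularValue A i :=
  (Fin.sum_univ_eq_sum_range (fun i => singularValue A i) n).symm

/-- The matrix whose columns are the vectors of an orthonormal basis is orthogonal. -/
lemma transpose_mul_self_of_orthonormalBasis {n : ℕ}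
    (b : OrthonormalBasis (Fin n) ℝ (EuclideanSpace ℝ (Fin n))) :
    (Matrix.of fun j i => b i j)ᵀ * (Matrix.of fun j i => b i j) = (1 : Matrix _ _ ℝ) := by
  ext i j
  have := orthonormal_iff_ite.1 b.orthonormal i j
  simp only [PiLp.inner_apply, RCLike.inner_apply, conj_trivial] at this
  simp only [Matrix.mul_apply, Matrix.transpose_apply, Matrix.of_apply, Matrix.one_apply]
  rw [← this]
  exact Finset.sum_congr rfl fun k _ => mul_comm _ _

/-- The spectral decomposition of the Gram matrix in terms of the singular values. -/
lemma exists_gram_eq {m n : ℕ} (A : Matrix (Fin m) (Fin n) ℝ) :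
    ∃ W : Matrix (Fin n) (Fin n) ℝ, Wᵀ * W = 1 ∧
      Aᵀ * A = W * diagonal (fun i : Fin n => singularValue A i ^ 2) * Wᵀ := by
  set T := Matrix.toEuclideanLin A with hT
  have hn : Module.finrank ℝ (EuclideanSpace ℝ (Fin n)) = n := by simp
  set b := T.isSymmetric_adjoint_comp_self.eigenvectorBasis hn with hb
  set W : Matrix (Fin n) (Fin n) ℝ := Matrix.of fun j i => b i j with hW
  have hWW : Wᵀ * W = 1 := transpose_mul_self_of_orthonormalBasis b
  refine ⟨W, hWW, ?_⟩
  have key : (Aᵀ * A) * W = W * diagonal (fun i : Fin n => singularValue A i ^ 2) := by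
    ext j i
    have h1 := T.isSymmetric_adjoint_comp_self.apply_eigenvectorBasis hn i
    rw [← T.sq_singularValues_fin hn i, ← hb, hT, ← Matrix.toEuclideanLin_conjTranspose_eq_adjoint] at h1
    have h2 := congrArg (fun x => x.ofLp j) h1
    simp only [LinearMap.comp_apply, Matrix.ofLp_toLpLin, Matrix.toLin'_apply,
      Matrix.conjTranspose_eq_transpose_of_trivial, Matrix.mulVec_mulVec] at h2
    rw [Matrix.mul_diagonal]
    simp only [Matrix.mulVec, dotProduct] at h2
    rw [Matrix.mul_apply]
    simp only [hW, Matrix.of_apply]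
    rw [h2]
    simp [singularValue, mul_comm]
  rw [← key, Matrix.mul_assoc, mul_eq_one_comm.1 hWW, Matrix.mul_one]

/-! ### Nuclear norm and orthogonal projections. -/

lemma trace_conj_orthogonal {n : ℕ} {W : Matrix (Fin n) (Fin n) ℝ} (hW : Wᵀ * W = 1)
    (A : Matrix (Fin n) (Fin n) ℝ) : (Wᵀ * A * W).trace = A.trace := by
  rw [Matrix.trace_mul_comm, ← Matrix.mul_assoc, mul_eq_one_comm.1 hW, Matrix.one_mul]

/-- A matrix `C` with `P C = P` for an orthogonal projection `P` has nuclear norm at least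
`trace P`, and it is `P` itself in case of equality. -/
lemma trace_le_nuclearNorm {n : ℕ} {P C : Matrix (Fin n) (Fin n) ℝ} (hP : Pᵀ = P)
    (hPP : P * P = P) (hPC : P * C = P) :
    P.trace ≤ nuclearNorm C ∧ (nuclearNorm C ≤ P.trace → C = P) := by
  obtain ⟨W, hW, hG⟩ := exists_gram_eq C
  have hW' : W * Wᵀ = 1 := mul_eq_one_comm.1 hW
  -- The columns of `Y` are orthogonal with lengths `σᵢ(C)`; splitting each along `P` and `Q = 1 -
  -- P` can only shorten its `P` part.
  set Y := C * W with hY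
  have hYY : Yᵀ * Y = diagonal (fun i : Fin n => singularValue C i ^ 2) := by
    calc Yᵀ * Y = Wᵀ * (Cᵀ * C) * W := by
          simp only [hY, Matrix.transpose_mul, Matrix.mul_assoc]
      _ = (Wᵀ * W) * diagonal (fun i : Fin n => singularValue C i ^ 2) * (Wᵀ * W) := by
          rw [hG]; simp only [Matrix.mul_assoc]
      _ = _ := by rw [hW, Matrix.one_mul, Matrix.mul_one]
  obtain ⟨Q, hQ⟩ : ∃ Q : Matrix (Fin n) (Fin n) ℝ, Q = 1 - P := ⟨_, rfl⟩
  have hsplit : Yᵀ * Y = (P * Y)ᵀ * (P * Y) + (Q * Y)ᵀ * (Q * Y) := by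
    have h1 : (P * Y)ᵀ * (P * Y) = Yᵀ * (P * P) * Y := by
      simp only [Matrix.transpose_mul, hP, Matrix.mul_assoc]
    have h2 : (Q * Y)ᵀ * (Q * Y) = Yᵀ * (Q * Q) * Y := by
      simp only [Matrix.transpose_mul, hQ, Matrix.transpose_sub, Matrix.transpose_one,
        hP, Matrix.mul_assoc]
    have h3 : Q * Q = Q := by
      simp [hQ, Matrix.mul_sub, Matrix.sub_mul, hPP]
    rw [h1, h2, h3, hPP, ← Matrix.add_mul, ← Matrix.mul_add, hQ]
    simp
  have hdiag : ∀ i : Fin n, singularValue C i ^ 2 =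
      ((P * Y)ᵀ * (P * Y)) i i + ((Q * Y)ᵀ * (Q * Y)) i i := fun i => by
    have := congrFun (congrFun (hYY.symm.trans hsplit) i) i
    simpa using this
  -- Cauchy–Schwarz against the unit columns of `W`.
  have hCS : ∀ i : Fin n, (Wᵀ * (P * Y)) i i ^ 2 ≤ ((P * Y)ᵀ * (P * Y)) i i := fun i => by
    have := diag_transpose_mul_sq_le W (P * Y) i
    rwa [hW, Matrix.one_apply_eq, one_mul] at this
  have hle : ∀ i : Fin n, (Wᵀ * (P * Y)) i i ≤ singularValue C i := fun i => by
    refine le_of_sq_le_sq ?_ (singularValue_nonneg C i)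
    rw [hdiag]
    exact (hCS i).trans (le_add_of_nonneg_right (gram_diag_nonneg _ i))
  have htr : P.trace = ∑ i : Fin n, (Wᵀ * (P * Y)) i i := by
    rw [← trace_conj_orthogonal hW P]
    conv_lhs => rw [← hPC]
    simp only [Matrix.trace, Matrix.diag, hY, Matrix.mul_assoc]
  rw [nuclearNorm_eq_sum_fin]
  refine ⟨htr.le.trans (Finset.sum_le_sum fun i _ => hle i), fun h => ?_⟩
  have heq : ∀ i : Fin n, (Wᵀ * (P * Y)) i i = singularValue C i := fun i =>
    (Finset.sum_eq_sum_iff_of_le fun i _ => hle i).1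
      (le_antisymm (Finset.sum_le_sum fun i _ => hle i) (h.trans htr.le)) i (Finset.mem_univ i)
  -- Equality of the traces leaves no length for the `Q` part of any column of `Y`.
  have hzero : Q * Y = 0 := by
    ext j i
    refine col_eq_zero_of_gram_diag ?_ j
    have h1 := hCS i
    rw [heq i, hdiag i] at h1
    linarith
  have hC : Q * C = 0 := by
    rw [← Matrix.mul_one (Q * C), ← hW', ← Matrix.mul_assoc, Matrix.mul_assoc Q,
      ← hY, hzero, Matrix.zero_mul]
  rw [hQ, Matrix.sub_mul, Matrix.one_mul, hPC] at hC
  exact sub_eq_zero.1 hC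

/-- The Gram matrix of `P` is `P` itself, so the squared singular values are idempotent, that is `0`
or `1`, and agree with the singular values. -/
lemma nuclearNorm_of_proj {n : ℕ} {P : Matrix (Fin n) (Fin n) ℝ} (hP : Pᵀ = P)
    (hPP : P * P = P) : nuclearNorm P = P.trace := by
  obtain ⟨W, hW, hG⟩ := exists_gram_eq P
  rw [hP, hPP] at hG
  set d := fun i : Fin n => singularValue P i ^ 2 with hd
  have hdd : diagonal d = Wᵀ * P * W := by
    rw [hG]
    calc diagonal d = (Wᵀ * W) * diagonal d * (Wᵀ * W) := by
          rw [hW, Matrix.one_mul, Matrix.mul_one]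
      _ = _ := by simp only [Matrix.mul_assoc]
  have hidem : diagonal d * diagonal d = diagonal d := by
    calc diagonal d * diagonal d = Wᵀ * P * (W * Wᵀ) * P * W := by
          rw [hdd]; simp only [Matrix.mul_assoc]
      _ = diagonal d := by
          rw [mul_eq_one_comm.1 hW, Matrix.mul_one, Matrix.mul_assoc Wᵀ, hPP, hdd]
  have hsv : ∀ i : Fin n, singularValue P i = d i := fun i => by
    rw [Matrix.diagonal_mul_diagonal] at hidem
    have h1 := congrFun (Matrix.diagonal_injective hidem) i
    simp only [hd] at h1 ⊢
    have h2 : singularValue P i ^ 2 = 0 ∨ singularValue P i ^ 2 = 1 := by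
      rcases eq_or_ne (singularValue P i ^ 2) 0 with h | h
      · exact Or.inl h
      · exact Or.inr (mul_left_cancel₀ h (by rw [h1, mul_one]))
    rcases h2 with h | h
    · rw [h]; exact pow_eq_zero_iff two_ne_zero |>.1 h
    · rw [h]; exact (pow_eq_one_iff_of_nonneg (singularValue_nonneg P i) two_ne_zero).1 h
  rw [nuclearNorm_eq_sum_fin, ← trace_conj_orthogonal hW, ← hdd, Matrix.trace_diagonal]
  exact Finset.sum_congr rfl fun i _ => hsv i

lemma trace_gram_mul_proj {m n : ℕ} (A : Matrix (Fin m) (Fin n) ℝ) {P : Matrix (Fin n) (Fin n) ℝ}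
    (hP : Pᵀ = P) (hPP : P * P = P) : (Aᵀ * A * P).trace = ‖A * P‖ ^ 2 := by
  rw [frobenius_norm_sq_eq_trace, Matrix.transpose_mul, hP, Matrix.mul_assoc P,
    Matrix.trace_mul_comm P]
  simp only [Matrix.mul_assoc, hPP]

lemma transpose_one_sub {n : ℕ} {P : Matrix (Fin n) (Fin n) ℝ} (hP : Pᵀ = P) :
    (1 - P)ᵀ = 1 - P := by
  rw [Matrix.transpose_sub, Matrix.transpose_one, hP]

lemma one_sub_mul_one_sub {n : ℕ} {P : Matrix (Fin n) (Fin n) ℝ} (hPP : P * P = P) :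
    (1 - P) * (1 - P) = 1 - P := by
  simp [Matrix.mul_sub, Matrix.sub_mul, hPP]

/-- `D - D₀` and `D` agree after multiplication by `1 - P`, which does not increase the Frobenius
norm. -/
lemma trace_gram_mul_one_sub_le {m n : ℕ} {D D₀ : Matrix (Fin m) (Fin n) ℝ}
    {P : Matrix (Fin n) (Fin n) ℝ} (hP : Pᵀ = P) (hPP : P * P = P) (hD₀ : D₀ * P = D₀) :
    (Dᵀ * D * (1 - P)).trace ≤ ‖D - D₀‖ ^ 2 := by
  have h1 : (D - D₀) * (1 - P) = D * (1 - P) := by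
    simp [Matrix.mul_sub, Matrix.sub_mul, hD₀]
  rw [trace_gram_mul_proj D (transpose_one_sub hP) (one_sub_mul_one_sub hPP), ← h1,
    ← trace_gram_mul_proj _ (transpose_one_sub hP) (one_sub_mul_one_sub hPP),
    frobenius_norm_sq_eq_trace, Matrix.mul_sub, Matrix.mul_one, Matrix.trace_sub,
    trace_gram_mul_proj _ hP hPP]
  exact sub_le_self _ (sq_nonneg _)

/-! ### Extending the right factor of a skinny SVD to an orthogonal matrix. -/

/-- For `V` consisting of the first `r` columns of `W`, a spectral sum over `V` is one over `W`. -/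
lemma mul_diagonal_mul_transpose_of_castLE {n r : ℕ} (h : r ≤ n) {V : Matrix (Fin n) (Fin r) ℝ}
    {W : Matrix (Fin n) (Fin n) ℝ} (hVW : ∀ j i, V j i = W j (Fin.castLE h i)) (d : Fin r → ℝ)
    (e : Fin n → ℝ) (hed : ∀ i, e (Fin.castLE h i) = d i)
    (he : ∀ i : Fin n, r ≤ (i : ℕ) → e i = 0) :
    V * diagonal d * Vᵀ = W * diagonal e * Wᵀ := by
  ext a b
  rw [Matrix.mul_apply, Matrix.mul_apply]
  simp only [Matrix.mul_diagonal, Matrix.transpose_apply, hVW, ← hed]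
  obtain ⟨t, rfl⟩ := exists_add_of_le h
  rw [Fin.sum_univ_add]
  rw [Finset.sum_eq_zero (f := fun i : Fin t => _) fun i _ => by
    rw [he _ (by simp), mul_zero, zero_mul], add_zero]
  rfl

lemma le_of_transpose_mul_self_eq_one {n r : ℕ} {V : Matrix (Fin n) (Fin r) ℝ}
    (hV : Vᵀ * V = 1) : r ≤ n := by
  have h1 : (1 : Matrix (Fin r) (Fin r) ℝ).rank = r := by simp
  have h2 := Matrix.rank_mul_le_right Vᵀ V
  rw [hV, h1] at h2
  exact h2.trans (by simpa using V.rank_le_height)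

lemma exists_orthogonal_extension {n r : ℕ} {V : Matrix (Fin n) (Fin r) ℝ} (hV : Vᵀ * V = 1)
    (h : r ≤ n) : ∃ W : Matrix (Fin n) (Fin n) ℝ, Wᵀ * W = 1 ∧
      ∀ j i, V j i = W j (Fin.castLE h i) := by
  let v : Fin n → EuclideanSpace ℝ (Fin n) := fun i =>
    if hi : (i : ℕ) < r then WithLp.toLp 2 fun j => V j ⟨i, hi⟩ else 0
  let s : Set (Fin n) := {i | (i : ℕ) < r}
  have hv : Orthonormal ℝ (s.domRestrict v) := by
    rw [orthonormal_iff_ite]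
    rintro ⟨i, hi⟩ ⟨j, hj⟩
    have hi' : (i : ℕ) < r := hi
    have hj' : (j : ℕ) < r := hj
    have := congrFun (congrFun hV ⟨i, hi'⟩) ⟨j, hj'⟩
    simp only [Matrix.mul_apply, Matrix.transpose_apply, Matrix.one_apply, Fin.mk.injEq] at this
    simp only [Set.domRestrict_apply, v, hi', hj', dif_pos, PiLp.inner_apply, RCLike.inner_apply,
      conj_trivial, Subtype.mk.injEq, Fin.ext_iff]
    rw [← this]
    exact Finset.sum_congr rfl fun k _ => mul_comm _ _
  obtain ⟨b, hb⟩ := hv.exists_orthonormalBasis_extension_of_card_eq (by simp)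
  refine ⟨Matrix.of fun j i => b i j, transpose_mul_self_of_orthonormalBasis b, fun j i => ?_⟩
  have hi : ((Fin.castLE h i : Fin n) : ℕ) < r := i.2
  rw [Matrix.of_apply, hb _ hi]
  simp [v]

/-- Both diagonals list the roots of the same characteristic polynomial with multiplicity, and a
sorted listing is unique. -/
lemma eq_of_antitone_of_conj_diagonal {n : ℕ} {W W' : Matrix (Fin n) (Fin n) ℝ}
    (hW : Wᵀ * W = 1) (hW' : W'ᵀ * W' = 1) {d e : Fin n → ℝ} (hd : Antitone d) (he : Antitone e)
    (h : W * diagonal d * Wᵀ = W' * diagonal e * W'ᵀ) : d = e := by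
  have key : ∀ (Z : Matrix (Fin n) (Fin n) ℝ) (f : Fin n → ℝ), Zᵀ * Z = 1 →
      (Z * diagonal f * Zᵀ).charpoly.roots = (List.ofFn f : Multiset ℝ) := fun Z f hZ => by
    rw [Matrix.charpoly_mul_comm, ← Matrix.mul_assoc, hZ, Matrix.one_mul,
      Matrix.charpoly_diagonal, Polynomial.roots_prod _ _
        (Finset.prod_ne_zero_iff.2 fun i _ => Polynomial.X_sub_C_ne_zero _)]
    simp_rw [Polynomial.roots_X_sub_C, Multiset.bind_singleton, Fin.univ_val_map]
  have h1 : (List.ofFn d : Multiset ℝ) = (List.ofFn e : Multiset ℝ) := by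
    rw [← key W d hW, ← key W' e hW', h]
  rw [Multiset.coe_eq_coe] at h1
  exact List.ofFn_injective (h1.eq_of_pairwise' hd.sortedGE_ofFn.pairwise he.sortedGE_ofFn.pairwise)

lemma gram_of_skinnySVD {m n r : ℕ} {D : Matrix (Fin m) (Fin n) ℝ} {U : Matrix (Fin m) (Fin r) ℝ}
    {s : Fin r → ℝ} {V : Matrix (Fin n) (Fin r) ℝ} (h : IsSkinnySVD D U s V) :
    Dᵀ * D = V * diagonal (fun i => s i ^ 2) * Vᵀ := by
  rw [h.eq]
  simp only [Matrix.transpose_mul, Matrix.transpose_transpose, Matrix.diagonal_transpose]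
  calc V * (diagonal s * Uᵀ) * (U * diagonal s * Vᵀ)
      = V * (diagonal s * (Uᵀ * U) * diagonal s) * Vᵀ := by simp only [Matrix.mul_assoc]
    _ = _ := by
      rw [h.left_orthonormal, Matrix.mul_one, Matrix.diagonal_mul_diagonal]
      simp only [sq]

/-- The right factor of a skinny SVD extends to an orthogonal matrix that diagonalises the Gram
matrix, and its diagonal entries are the nonzero singular values. -/
lemma exists_extension_of_skinnySVD {m n r : ℕ} {D : Matrix (Fin m) (Fin n) ℝ}
    {U : Matrix (Fin m) (Fin r) ℝ} {s : Fin r → ℝ} {V : Matrix (Fin n) (Fin r) ℝ}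
    (h : IsSkinnySVD D U s V) :
    ∃ (hr : r ≤ n) (W : Matrix (Fin n) (Fin n) ℝ), Wᵀ * W = 1 ∧
      (∀ j i, V j i = W j (Fin.castLE hr i)) ∧
      Dᵀ * D = W * diagonal (fun i : Fin n => singularValue D i ^ 2) * Wᵀ ∧
      ∀ i : ℕ, r ≤ i → singularValue D i = 0 := by
  have hr := le_of_transpose_mul_self_eq_one h.right_orthonormal
  obtain ⟨W, hW, hVW⟩ := exists_orthogonal_extension h.right_orthonormal hr
  set e : Fin n → ℝ := fun i => if hi : (i : ℕ) < r then s ⟨i, hi⟩ ^ 2 else 0 with he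
  have hG : Dᵀ * D = W * diagonal e * Wᵀ := by
    rw [gram_of_skinnySVD h]
    refine mul_diagonal_mul_transpose_of_castLE hr hVW _ _ (fun i => ?_) fun i hi => ?_
    · simp [he]
    · simp [he, hi.not_gt]
  have hanti : Antitone e := by
    intro i j hij
    have hij' : (i : ℕ) ≤ j := hij
    simp only [he]
    split_ifs with h1 h2
    · exact pow_le_pow_left₀ (h.pos _).le (h.antitone hij) 2
    · omega
    · positivity
    · exact le_rfl
  obtain ⟨W', hW', hG'⟩ := exists_gram_eq D
  have hsq : e = fun i : Fin n => singularValue D i ^ 2 :=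
    eq_of_antitone_of_conj_diagonal hW hW' hanti
      (fun i j hij => pow_le_pow_left₀ (singularValue_nonneg D j)
        (singularValue_antitone D hij) 2) (hG.symm.trans hG')
  refine ⟨hr, W, hW, hVW, hsq ▸ hG, fun i hi => ?_⟩
  rcases lt_or_ge i n with hin | hin
  · have := congrFun hsq ⟨i, hin⟩
    simp only [he, hi.not_gt, dif_neg, not_false_iff] at this
    exact (pow_eq_zero_iff two_ne_zero).1 this.symm
  · exact singularValue_of_le D hin

lemma transpose_mul_transpose_self {n r : ℕ} (V : Matrix (Fin n) (Fin r) ℝ) : (V * Vᵀ)ᵀ = V * Vᵀ := by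
  simp

lemma proj_mul_proj {n r : ℕ} {V : Matrix (Fin n) (Fin r) ℝ} (hV : Vᵀ * V = 1) :
    (V * Vᵀ) * (V * Vᵀ) = V * Vᵀ := by
  rw [Matrix.mul_assoc, ← Matrix.mul_assoc Vᵀ, hV, Matrix.one_mul]

/-! ### Existence of skinny SVDs. -/

lemma exists_skinnySVD {m n : ℕ} (D : Matrix (Fin m) (Fin n) ℝ) :
    ∃ (r : ℕ) (U : Matrix (Fin m) (Fin r) ℝ) (s : Fin r → ℝ) (V : Matrix (Fin n) (Fin r) ℝ),
      IsSkinnySVD D U s V := by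
  obtain ⟨W, hW, hG⟩ := exists_gram_eq D
  set T := Matrix.toEuclideanLin D with hT
  set r := Module.finrank ℝ (LinearMap.range T) with hrdef
  have hr : r ≤ n := (LinearMap.finrank_range_le T).trans (by simp)
  have hpos : ∀ i : Fin r, 0 < singularValue D i := fun i =>
    T.singularValues_pos_iff_lt_finrank_range.2 i.2
  set V : Matrix (Fin n) (Fin r) ℝ := W.submatrix id (Fin.castLE hr) with hV
  set s : Fin r → ℝ := fun i => singularValue D i with hs
  have hVV : Vᵀ * V = 1 := by
    ext i j
    have := congrFun (congrFun hW (Fin.castLE hr i)) (Fin.castLE hr j)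
    simpa [Matrix.mul_apply, Matrix.one_apply, hV] using this
  have hGV : Dᵀ * D = V * diagonal (fun i => s i ^ 2) * Vᵀ := by
    rw [hG]
    refine (mul_diagonal_mul_transpose_of_castLE hr (fun _ _ => rfl) _ _ (fun i => rfl)
      fun i hi => ?_).symm
    have : singularValue D i = 0 := T.singularValues_eq_zero_iff_le_finrank_range.2 hi
    simp [this]
  -- `Dᵀ D` kills `1 - V Vᵀ`, hence `‖D (1 - V Vᵀ)‖² = 0`.
  have hDV : D * (V * Vᵀ) = D := by
    have hP := transpose_mul_transpose_self V
    have hPP := proj_mul_proj hVV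
    have h0 : Dᵀ * D * (1 - V * Vᵀ) = 0 := by
      rw [hGV, Matrix.mul_sub, Matrix.mul_one, Matrix.mul_assoc _ Vᵀ, ← Matrix.mul_assoc Vᵀ, hVV,
        Matrix.one_mul, sub_self]
    have h1 := trace_gram_mul_proj D (transpose_one_sub hP) (one_sub_mul_one_sub hPP)
    rw [h0, Matrix.trace_zero] at h1
    have h2 := norm_eq_zero.1 ((pow_eq_zero_iff two_ne_zero).1 h1.symm)
    rw [Matrix.mul_sub, Matrix.mul_one] at h2
    exact (sub_eq_zero.1 h2).symm
  have hinv : diagonal (fun i => (s i)⁻¹) * diagonal s = 1 := by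
    rw [Matrix.diagonal_mul_diagonal, ← Matrix.diagonal_one]
    exact congrArg _ (funext fun i => inv_mul_cancel₀ (hpos i).ne')
  refine ⟨r, D * V * diagonal (fun i => (s i)⁻¹), s, V, ⟨?_, hVV, hpos, fun i j hij =>
    singularValue_antitone D hij, ?_⟩⟩
  · simp only [Matrix.transpose_mul, Matrix.diagonal_transpose]
    calc diagonal (fun i => (s i)⁻¹) * (Vᵀ * Dᵀ) * (D * V * diagonal (fun i => (s i)⁻¹))
        = diagonal (fun i => (s i)⁻¹) * Vᵀ * (Dᵀ * D) * V * diagonal (fun i => (s i)⁻¹) := by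
          simp only [Matrix.mul_assoc]
      _ = diagonal (fun i => (s i)⁻¹) * (Vᵀ * V) * diagonal (fun i => s i ^ 2) * (Vᵀ * V) *
          diagonal (fun i => (s i)⁻¹) := by rw [hGV]; simp only [Matrix.mul_assoc]
      _ = 1 := by
        rw [hVV, Matrix.mul_one, Matrix.mul_one, Matrix.diagonal_mul_diagonal,
          Matrix.diagonal_mul_diagonal, ← Matrix.diagonal_one]
        refine congrArg _ (funext fun i => ?_)
        have := (hpos i).ne'
        simp only [hs]
        field_simp
  · rw [Matrix.mul_assoc (D * V), hinv, Matrix.mul_one, Matrix.mul_assoc, hDV]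

/-! ### The clean problem. -/

section RowProjection

variable {m n r : ℕ} {D : Matrix (Fin m) (Fin n) ℝ} {U : Matrix (Fin m) (Fin r) ℝ}
  {s : Fin r → ℝ} {V : Matrix (Fin n) (Fin r) ℝ}

lemma mul_rowProj (h : IsSkinnySVD D U s V) : D * (V * Vᵀ) = D := by
  rw [h.eq, Matrix.mul_assoc, ← Matrix.mul_assoc Vᵀ, h.right_orthonormal, Matrix.one_mul]

/-- `Vᵀ = Σ⁻¹ Uᵀ D` is a left multiple of `D`, so it inherits `D = D C`. -/
lemma rowProj_mul (h : IsSkinnySVD D U s V) {C : Matrix (Fin n) (Fin n) ℝ} (hC : D = D * C) :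
    V * Vᵀ * C = V * Vᵀ := by
  have hX : diagonal (fun i => (s i)⁻¹) * Uᵀ * D = Vᵀ := by
    rw [h.eq]
    calc diagonal (fun i => (s i)⁻¹) * Uᵀ * (U * diagonal s * Vᵀ)
        = diagonal (fun i => (s i)⁻¹) * (Uᵀ * U) * diagonal s * Vᵀ := by
          simp only [Matrix.mul_assoc]
      _ = Vᵀ := by
        rw [h.left_orthonormal, Matrix.mul_one, Matrix.diagonal_mul_diagonal]
        simp [(h.pos _).ne']
  rw [Matrix.mul_assoc, ← hX, Matrix.mul_assoc _ D, ← hC]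

/-- The projection onto the row space is the only solution of `min ‖C‖_*` subject to `D = D C`. -/
lemma isCleanOptimal_iff (h : IsSkinnySVD D U s V) (C : Matrix (Fin n) (Fin n) ℝ) :
    IsCleanOptimal D C ↔ C = V * Vᵀ := by
  have hP := transpose_mul_transpose_self V
  have hPP := proj_mul_proj h.right_orthonormal
  constructor
  · rintro ⟨hC, hopt⟩
    refine (trace_le_nuclearNorm hP hPP (rowProj_mul h hC)).2 ?_
    rw [← nuclearNorm_of_proj hP hPP]
    exact hopt _ (mul_rowProj h).symm
  · rintro rfl
    refine ⟨(mul_rowProj h).symm, fun C' hC' => ?_⟩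
    rw [nuclearNorm_of_proj hP hPP]
    exact (trace_le_nuclearNorm hP hPP (rowProj_mul h hC')).1

end RowProjection

/-- A skinny SVD of `V Vᵀ` with right factor `V` has left factor `V` and unit singular values. -/
lemma eq_of_skinnySVD_proj {n r : ℕ} {UC V : Matrix (Fin n) (Fin r) ℝ} {sC : Fin r → ℝ}
    (h : IsSkinnySVD (V * Vᵀ) UC sC V) : UC = V ∧ ∀ i, sC i = 1 := by
  have h1 : UC * diagonal sC = V := by
    calc UC * diagonal sC = UC * diagonal sC * Vᵀ * V := by
          rw [Matrix.mul_assoc _ Vᵀ, h.right_orthonormal, Matrix.mul_one]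
      _ = V := by rw [← h.eq, Matrix.mul_assoc, h.right_orthonormal, Matrix.mul_one]
  have h2 : diagonal sC * diagonal sC = 1 := by
    calc diagonal sC * diagonal sC = diagonal sC * (UCᵀ * UC) * diagonal sC := by
          rw [h.left_orthonormal, Matrix.mul_one]
      _ = (UC * diagonal sC)ᵀ * (UC * diagonal sC) := by
          simp only [Matrix.transpose_mul, Matrix.diagonal_transpose, Matrix.mul_assoc]
      _ = 1 := by rw [h1, h.right_orthonormal]
  have h3 : ∀ i, sC i = 1 := fun i => by
    rw [Matrix.diagonal_mul_diagonal, ← Matrix.diagonal_one] at h2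
    have := congrFun (Matrix.diagonal_injective h2) i
    nlinarith [h.pos i]
  refine ⟨?_, h3⟩
  rw [← h1, funext h3]
  simp

/-! ### Minimisers of the rank cost as thresholds for the singular values. -/

section RankCost

variable {m n : ℕ} {D : Matrix (Fin m) (Fin n) ℝ} {α : ℝ} {k : ℕ}

/-- The sign of this increment is what relates minimisers to the threshold `1`. For `k ≥ n` the
increment is `1`, as `σ` vanishes there. -/
lemma rankCost_succ (D : Matrix (Fin m) (Fin n) ℝ) (α : ℝ) (k : ℕ) :
    rankCost D α (k + 1) = rankCost D α k + (1 - α / 2 * singularValue D k ^ 2) := by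
  rw [rankCost, rankCost]
  rcases lt_or_ge k n with hk | hk
  · rw [Finset.sum_eq_sum_Ico_succ_bot hk]
    push_cast
    ring
  · rw [Finset.Ico_eq_empty (by omega), Finset.Ico_eq_empty (by omega), singularValue_of_le D hk]
    simp

lemma rankCost_eq_sum (D : Matrix (Fin m) (Fin n) ℝ) (α : ℝ) (hk : k ≤ n) :
    rankCost D α k =
      ∑ i : Fin n, if (i : ℕ) < k then 1 else α / 2 * singularValue D i ^ 2 := by
  rw [Fin.sum_univ_eq_sum_range (fun i => if i < k then 1 else α / 2 * singularValue D i ^ 2),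
    ← Finset.sum_range_add_sum_Ico _ hk, rankCost, Finset.mul_sum]
  congr 1
  · rw [Finset.sum_congr rfl fun i hi => if_pos (Finset.mem_range.1 hi)]
    simp
  · exact Finset.sum_congr rfl fun i hi => (if_neg (Finset.mem_Ico.1 hi).1.not_gt).symm

lemma IsArgmin.le_of_singularValue_eq_zero (hα : 0 ≤ α) (hk : IsArgmin D α k) {r : ℕ}
    (hr : ∀ i, r ≤ i → singularValue D i = 0) : k ≤ r := by
  have h := hk r
  rw [rankCost, rankCost, Finset.sum_eq_zero (s := Finset.Ico r n) fun i hi => by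
    rw [hr i (Finset.mem_Ico.1 hi).1]; simp, mul_zero, add_zero] at h
  have h0 : 0 ≤ α / 2 * ∑ i ∈ Finset.Ico k n, singularValue D i ^ 2 := by positivity
  exact_mod_cast (le_add_of_nonneg_right h0).trans h

/-- Comparison with `k + 1` settles index `k`; monotonicity of `σ` settles the rest. The next two
lemmas likewise compare `k` with a neighbour. -/
lemma IsArgmin.half_mul_sq_le_one (hα : 0 ≤ α) (hk : IsArgmin D α k) {i : ℕ} (hi : k ≤ i) :
    α / 2 * singularValue D i ^ 2 ≤ 1 := by
  have h := hk (k + 1)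
  rw [rankCost_succ] at h
  have := mul_le_mul_of_nonneg_left
    (pow_le_pow_left₀ (singularValue_nonneg D i) (singularValue_antitone D hi) 2)
    (by positivity : 0 ≤ α / 2)
  linarith

lemma IsArgmin.one_le_half_mul_sq (hα : 0 ≤ α) (hk : IsArgmin D α k) {i : ℕ} (hi : i < k) :
    1 ≤ α / 2 * singularValue D i ^ 2 := by
  obtain ⟨l, rfl⟩ := Nat.exists_eq_succ_of_ne_zero (Nat.ne_zero_of_lt hi)
  have h := hk l
  rw [Nat.succ_eq_add_one, rankCost_succ] at h
  have := mul_le_mul_of_nonneg_left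
    (pow_le_pow_left₀ (singularValue_nonneg D l) (singularValue_antitone D (Nat.lt_succ_iff.1 hi)) 2)
    (by positivity : 0 ≤ α / 2)
  linarith

lemma IsArgmin.half_mul_sq_ne_one (hα : 0 ≤ α) (hk : IsArgmin D α k)
    (huniq : ∀ j, IsArgmin D α j → j = k) (i : ℕ) : α / 2 * singularValue D i ^ 2 ≠ 1 := by
  have hlt : ∀ j, j ≠ k → rankCost D α k < rankCost D α j := fun j hj =>
    lt_of_not_ge fun h => hj (huniq j fun l => h.trans (hk l))
  rcases lt_or_ge i k with hi | hi
  · obtain ⟨l, rfl⟩ := Nat.exists_eq_succ_of_ne_zero (Nat.ne_zero_of_lt hi)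
    have h := hlt l (by simp)
    rw [Nat.succ_eq_add_one, rankCost_succ] at h
    have := mul_le_mul_of_nonneg_left (pow_le_pow_left₀ (singularValue_nonneg D l)
      (singularValue_antitone D (Nat.lt_succ_iff.1 hi)) 2) (by positivity : 0 ≤ α / 2)
    linarith
  · have h := hlt (k + 1) (by simp)
    rw [rankCost_succ] at h
    have := mul_le_mul_of_nonneg_left
      (pow_le_pow_left₀ (singularValue_nonneg D i) (singularValue_antitone D hi) 2)
      (by positivity : 0 ≤ α / 2)
    linarith

end RankCost

/-! ### The noisy problem. -/

section Noisy

variable {m n : ℕ} {D : Matrix (Fin m) (Fin n) ℝ} {α : ℝ} {k : ℕ} {W P : Matrix (Fin n) (Fin n) ℝ}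

lemma trace_add_trace_gram_mul_one_sub (hW : Wᵀ * W = 1)
    (hG : Dᵀ * D = W * diagonal (fun i : Fin n => singularValue D i ^ 2) * Wᵀ) (α : ℝ) :
    P.trace + α / 2 * (Dᵀ * D * (1 - P)).trace =
      ∑ i : Fin n, ((Wᵀ * P * W) i i +
        α / 2 * singularValue D i ^ 2 * (1 - (Wᵀ * P * W) i i)) := by
  have h1 : (Dᵀ * D * (1 - P)).trace =
      ∑ i : Fin n, singularValue D i ^ 2 * (1 - (Wᵀ * P * W) i i) := by
    have : Wᵀ * (1 - P) * W = 1 - Wᵀ * P * W := by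
      rw [Matrix.mul_sub, Matrix.sub_mul, Matrix.mul_one, hW]
    rw [hG, Matrix.mul_assoc, Matrix.mul_assoc, Matrix.trace_mul_comm, Matrix.mul_assoc, this]
    simp [Matrix.trace, Matrix.diagonal_mul]
  rw [h1, ← trace_conj_orthogonal hW P, Finset.sum_add_distrib, Finset.mul_sum]
  simp only [Matrix.trace, Matrix.diag, mul_assoc]

lemma conj_proj_apply (hP : Pᵀ = P) (hPP : P * P = P) (i : Fin n) :
    (Wᵀ * P * W) i i = ((P * W)ᵀ * (P * W)) i i := by
  rw [Matrix.transpose_mul, hP, Matrix.mul_assoc Wᵀ P (P * W), ← Matrix.mul_assoc P P, hPP,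
    Matrix.mul_assoc]

lemma one_sub_conj_proj_apply (hW : Wᵀ * W = 1) (hP : Pᵀ = P) (hPP : P * P = P) (i : Fin n) :
    1 - (Wᵀ * P * W) i i = (((1 - P) * W)ᵀ * ((1 - P) * W) : Matrix _ _ ℝ) i i := by
  rw [← conj_proj_apply (transpose_one_sub hP) (one_sub_mul_one_sub hPP), Matrix.mul_sub,
    Matrix.sub_mul, Matrix.mul_one, hW]
  simp

/-- The right side is a convex combination of `1` and `(α/2) σᵢ²` with weights `pᵢ` and `1 - pᵢ`;
the left side is the smaller of the two. Both weights are squared column lengths, hence nonnegative.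
-/
lemma IsArgmin.ite_le (hα : 0 ≤ α) (hk : IsArgmin D α k) (hW : Wᵀ * W = 1) (hP : Pᵀ = P)
    (hPP : P * P = P) (i : Fin n) :
    (if (i : ℕ) < k then 1 else α / 2 * singularValue D i ^ 2) ≤
      (Wᵀ * P * W) i i + α / 2 * singularValue D i ^ 2 * (1 - (Wᵀ * P * W) i i) := by
  have h0 : 0 ≤ (Wᵀ * P * W) i i := conj_proj_apply hP hPP i ▸ gram_diag_nonneg _ i
  have h1 : 0 ≤ 1 - (Wᵀ * P * W) i i :=
    one_sub_conj_proj_apply hW hP hPP i ▸ gram_diag_nonneg _ i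
  split_ifs with hi
  · nlinarith [hk.one_le_half_mul_sq hα hi]
  · nlinarith [hk.half_mul_sq_le_one hα (not_lt.1 hi)]

/-- The projection onto the span of the first `k` columns of an orthogonal matrix. -/
def leadingProj (W : Matrix (Fin n) (Fin n) ℝ) (k : ℕ) : Matrix (Fin n) (Fin n) ℝ :=
  W * diagonal (fun i : Fin n => if (i : ℕ) < k then 1 else 0) * Wᵀ

lemma transpose_leadingProj (W : Matrix (Fin n) (Fin n) ℝ) (k : ℕ) :
    (leadingProj W k)ᵀ = leadingProj W k := by
  simp [leadingProj, Matrix.mul_assoc]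

lemma conj_leadingProj (hW : Wᵀ * W = 1) (k : ℕ) :
    Wᵀ * leadingProj W k * W = diagonal (fun i : Fin n => if (i : ℕ) < k then (1 : ℝ) else 0) := by
  rw [leadingProj, ← Matrix.mul_assoc, ← Matrix.mul_assoc, hW, Matrix.one_mul, Matrix.mul_assoc, hW,
    Matrix.mul_one]

lemma leadingProj_mul_self (hW : Wᵀ * W = 1) (k : ℕ) :
    leadingProj W k * leadingProj W k = leadingProj W k := by
  set d := diagonal (fun i : Fin n => if (i : ℕ) < k then (1 : ℝ) else 0) with hd
  have hdd : d * d = d := by simp [hd, Matrix.diagonal_mul_diagonal]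
  calc W * d * Wᵀ * (W * d * Wᵀ) = W * (d * (Wᵀ * W) * d) * Wᵀ := by simp only [Matrix.mul_assoc]
    _ = leadingProj W k := by rw [hW, Matrix.mul_one, hdd, leadingProj]

/-- Every feasible point comes with a projection `P` onto the row space of `D₀`. -/
lemma IsFeasible.exists_proj {C₀ : Matrix (Fin n) (Fin n) ℝ} {D₀ Dₑ : Matrix (Fin m) (Fin n) ℝ}
    (h : IsFeasible D C₀ D₀ Dₑ) :
    ∃ P : Matrix (Fin n) (Fin n) ℝ, Pᵀ = P ∧ P * P = P ∧ P * C₀ = P ∧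
      (Dᵀ * D * (1 - P)).trace ≤ ‖Dₑ‖ ^ 2 := by
  obtain ⟨r, U, s, V, hV⟩ := exists_skinnySVD D₀
  have hP := transpose_mul_transpose_self V
  have hPP := proj_mul_proj hV.right_orthonormal
  refine ⟨V * Vᵀ, hP, hPP, rowProj_mul hV h.1, ?_⟩
  have hD : Dₑ = D - D₀ := by rw [h.2, add_sub_cancel_left]
  rw [hD]
  exact trace_gram_mul_one_sub_le hP hPP (mul_rowProj hV)

lemma objective_proj (hW : Wᵀ * W = 1)
    (hG : Dᵀ * D = W * diagonal (fun i : Fin n => singularValue D i ^ 2) * Wᵀ)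
    (hP : Pᵀ = P) (hPP : P * P = P) (α : ℝ) :
    objective α P (D - D * P) = ∑ i : Fin n, ((Wᵀ * P * W) i i +
        α / 2 * singularValue D i ^ 2 * (1 - (Wᵀ * P * W) i i)) := by
  have h : D - D * P = D * (1 - P) := by rw [Matrix.mul_sub, Matrix.mul_one]
  rw [objective, h, ← trace_gram_mul_proj D (transpose_one_sub hP) (one_sub_mul_one_sub hPP),
    nuclearNorm_of_proj hP hPP, trace_add_trace_gram_mul_one_sub hW hG]

lemma objective_leadingProj (hW : Wᵀ * W = 1)
    (hG : Dᵀ * D = W * diagonal (fun i : Fin n => singularValue D i ^ 2) * Wᵀ) (hkn : k ≤ n)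
    (α : ℝ) : objective α (leadingProj W k) (D - D * leadingProj W k) = rankCost D α k := by
  rw [objective_proj hW hG (transpose_leadingProj W k) (leadingProj_mul_self hW k),
    conj_leadingProj hW, rankCost_eq_sum D α hkn]
  refine Finset.sum_congr rfl fun i _ => ?_
  rw [Matrix.diagonal_apply_eq]
  split_ifs <;> ring

lemma rankCost_le_objective (hα : 0 ≤ α) (hk : IsArgmin D α k) (hkn : k ≤ n) (hW : Wᵀ * W = 1)
    (hG : Dᵀ * D = W * diagonal (fun i : Fin n => singularValue D i ^ 2) * Wᵀ)
    {C₀ : Matrix (Fin n) (Fin n) ℝ} {D₀ Dₑ : Matrix (Fin m) (Fin n) ℝ}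
    (h : IsFeasible D C₀ D₀ Dₑ) : rankCost D α k ≤ objective α C₀ Dₑ := by
  obtain ⟨P, hP, hPP, hPC, hle⟩ := h.exists_proj
  calc rankCost D α k ≤ P.trace + α / 2 * (Dᵀ * D * (1 - P)).trace := by
        rw [trace_add_trace_gram_mul_one_sub hW hG, rankCost_eq_sum D α hkn]
        exact Finset.sum_le_sum fun i _ => hk.ite_le hα hW hP hPP i
    _ ≤ objective α C₀ Dₑ := add_le_add (trace_le_nuclearNorm hP hPP hPC).1
        (mul_le_mul_of_nonneg_left hle (by positivity))

lemma isNoisyOptimal_leadingProj (hα : 0 ≤ α) (hk : IsArgmin D α k) (hkn : k ≤ n)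
    (hW : Wᵀ * W = 1)
    (hG : Dᵀ * D = W * diagonal (fun i : Fin n => singularValue D i ^ 2) * Wᵀ) :
    IsNoisyOptimal D α (leadingProj W k) (D * leadingProj W k) (D - D * leadingProj W k) := by
  refine ⟨⟨?_, by simp⟩, fun C₀ D₀ Dₑ h => ?_⟩
  · rw [Matrix.mul_assoc, leadingProj_mul_self hW]
  · rw [objective_leadingProj hW hG hkn]
    exact rankCost_le_objective hα hk hkn hW hG h

lemma eq_leadingProj_of_isNoisyOptimal (hα : 0 ≤ α) (hk : IsArgmin D α k)
    (huniq : ∀ j, IsArgmin D α j → j = k) (hkn : k ≤ n) (hW : Wᵀ * W = 1)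
    (hG : Dᵀ * D = W * diagonal (fun i : Fin n => singularValue D i ^ 2) * Wᵀ)
    {C₀ : Matrix (Fin n) (Fin n) ℝ} {D₀ Dₑ : Matrix (Fin m) (Fin n) ℝ}
    (h : IsNoisyOptimal D α C₀ D₀ Dₑ) : C₀ = leadingProj W k := by
  have hopt := h.2 _ _ _ (isNoisyOptimal_leadingProj hα hk hkn hW hG).1
  rw [objective_leadingProj hW hG hkn] at hopt
  obtain ⟨P, hP, hPP, hPC, hle⟩ := h.1.exists_proj
  have hnuc := trace_le_nuclearNorm hP hPP hPC
  have hle' := mul_le_mul_of_nonneg_left hle (by positivity : 0 ≤ α / 2)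
  have hsum := trace_add_trace_gram_mul_one_sub (P := P) hW hG α
  have hterm := fun (i : Fin n) (_ : i ∈ Finset.univ) => hk.ite_le hα hW hP hPP i
  have hsum_le := Finset.sum_le_sum hterm
  rw [← rankCost_eq_sum D α hkn, ← hsum] at hsum_le
  rw [objective] at hopt
  have hCP : C₀ = P := hnuc.2 (by linarith)
  -- Optimality collapses the chain of lower bounds, so every summand attains its minimum.
  have heq := (Finset.sum_eq_sum_iff_of_le hterm).1 (by
    rw [← rankCost_eq_sum D α hkn, ← hsum]; linarith [hnuc.1])
  -- Without ties, `pᵢ = 1` for `i < k` and `pᵢ = 0` otherwise: column `i` of `W` is fixed or killed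
  -- by `P`.
  have hcol : P * W = W * diagonal (fun i : Fin n => if (i : ℕ) < k then (1 : ℝ) else 0) := by
    ext j i
    rw [Matrix.mul_diagonal]
    have hi := heq i (Finset.mem_univ i)
    have hne := sub_ne_zero.2 (hk.half_mul_sq_ne_one hα huniq i)
    split_ifs at hi ⊢ with hik
    · have h1 : 1 - (Wᵀ * P * W) i i = 0 :=
        (mul_eq_zero.1 (by linarith : (α / 2 * singularValue D i ^ 2 - 1) *
          (1 - (Wᵀ * P * W) i i) = 0)).resolve_left hne
      rw [one_sub_conj_proj_apply hW hP hPP] at h1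
      have h2 := col_eq_zero_of_gram_diag h1.le j
      rw [Matrix.sub_mul, Matrix.one_mul, Matrix.sub_apply] at h2
      rw [mul_one]
      linarith
    · have h1 : (Wᵀ * P * W) i i = 0 :=
        (mul_eq_zero.1 (by linarith : (α / 2 * singularValue D i ^ 2 - 1) *
          (Wᵀ * P * W) i i = 0)).resolve_left hne
      rw [conj_proj_apply hP hPP] at h1
      rw [col_eq_zero_of_gram_diag h1.le j, mul_zero]
  rw [hCP, leadingProj, ← hcol, Matrix.mul_assoc, mul_eq_one_comm.1 hW, Matrix.mul_one]

end Noisy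

end LowRankRep

theorem lemma6 {m n : ℕ} (D : Matrix (Fin m) (Fin n) ℝ) (α : ℝ) (hα : 0 ≤ α) :
    ∃ Cstar : Matrix (Fin n) (Fin n) ℝ,
      (∀ C : Matrix (Fin n) (Fin n) ℝ, LowRankRep.IsCleanOptimal D C ↔ C = Cstar) ∧
      (∃ (r : ℕ) (UC : Matrix (Fin n) (Fin r) ℝ) (sC : Fin r → ℝ) (VC : Matrix (Fin n) (Fin r) ℝ),
        LowRankRep.IsSkinnySVD Cstar UC sC VC ∧
        ∃ (U : Matrix (Fin m) (Fin r) ℝ) (s : Fin r → ℝ), LowRankRep.IsSkinnySVD D U s VC) ∧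
      ∀ (r : ℕ) (UC : Matrix (Fin n) (Fin r) ℝ) (sC : Fin r → ℝ) (VC : Matrix (Fin n) (Fin r) ℝ),
        LowRankRep.IsSkinnySVD Cstar UC sC VC →
        (∃ (U : Matrix (Fin m) (Fin r) ℝ) (s : Fin r → ℝ), LowRankRep.IsSkinnySVD D U s VC) →
        ∀ k : ℕ, LowRankRep.IsArgmin D α k →
          (∃ D₀ Dₑ : Matrix (Fin m) (Fin n) ℝ,
            LowRankRep.IsNoisyOptimal D α
              (UC * Matrix.diagonal (LowRankRep.truncate k sC) * VCᵀ) D₀ Dₑ) ∧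
          ((∀ j : ℕ, LowRankRep.IsArgmin D α j → j = k) →
            ∀ (C₀ : Matrix (Fin n) (Fin n) ℝ) (D₀ Dₑ : Matrix (Fin m) (Fin n) ℝ),
              LowRankRep.IsNoisyOptimal D α C₀ D₀ Dₑ →
                C₀ = UC * Matrix.diagonal (LowRankRep.truncate k sC) * VCᵀ) := by
  obtain ⟨r, U, s, V, hV⟩ := LowRankRep.exists_skinnySVD D
  refine ⟨V * Vᵀ, LowRankRep.isCleanOptimal_iff hV, ⟨r, V, fun _ => 1, V, ⟨hV.right_orthonormal,
    hV.right_orthonormal, fun _ => one_pos, antitone_const, by simp⟩, U, s, hV⟩, ?_⟩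
  rintro r' UC sC VC hC ⟨U', s', hV'⟩ k hk
  -- Both projections are the unique clean optimum, whichever skinny SVD of `D` supplies them.
  have hVV : V * Vᵀ = VC * VCᵀ := (LowRankRep.isCleanOptimal_iff hV' _).1
    ((LowRankRep.isCleanOptimal_iff hV _).2 rfl)
  rw [hVV] at hC
  obtain ⟨rfl, hs⟩ := LowRankRep.eq_of_skinnySVD_proj hC
  obtain ⟨hr, W, hW, hVW, hG, hzero⟩ := LowRankRep.exists_extension_of_skinnySVD hV'
  -- Needed so that the truncation keeps all of the first `k` columns of `W`, none of them lying
  -- beyond `VC`.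
  have hkr : k ≤ r' := hk.le_of_singularValue_eq_zero hα hzero
  have hC₀ : UC * Matrix.diagonal (LowRankRep.truncate k sC) * UCᵀ =
      LowRankRep.leadingProj W k := by
    refine LowRankRep.mul_diagonal_mul_transpose_of_castLE hr hVW _ _ (fun i => ?_) fun i hi => ?_
    · simp [LowRankRep.truncate, hs]
    · simp [(hkr.trans hi).not_gt]
  rw [hC₀]
  exact ⟨⟨_, _, LowRankRep.isNoisyOptimal_leadingProj hα hk (hkr.trans hr) hW hG⟩,
    fun huniq C₀ D₀ Dₑ h =>
      LowRankRep.eq_leadingProj_of_isNoisyOptimal hα hk huniq (hkr.trans hr) hW hG h⟩
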